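/- Corollary 4. Let $k$ be a (commutative) field, let $G$ be a group, and let $\mathcal{L}$ be a local system of $G$, that is, an upwardly directed collection of subgroups of $G$ whose union is $G$. Let $V$ be a finitary $kG$-module: a $k$-vector space, of arbitrary dimension, on which $G$ acts $k$-linearly in such a way that $(g-1)V$ is finite-dimensional over $k$ for every $g \in G$. Suppose that $V$ is locally completely reducible with respect to $\mathcal{L}$, that is, for every $L \in \mathcal{L}$ the restriction of $V$ to $L$ is a completely reducible $kL$-module. Let $[V,G]$ denote the $kG$-submodule of $V$ spanned over $k$ by all $gv - v$ with $g \in G$ and $v \in V$. Then $[V,G]$ is a completely reducible $kG$-module; that is, every $kG$-submodule $W$ of $[V,G]$ is a direct summand: there is a $kG$-submodule $W'$ of $[V,G]$ with $[V,G] = W \oplus W'$. -/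

import Mathlib

/-- A local system of a group `G`: an upwardly directed collection of subgroups of `G` whose
union is `G`. -/
structure IsLocalSystem {G : Type*} [Group G] (𝓛 : Set (Subgroup G)) : Prop where
  directed : ∀ L₁ ∈ 𝓛, ∀ L₂ ∈ 𝓛, ∃ L ∈ 𝓛, L₁ ≤ L ∧ L₂ ≤ L
  iUnion_eq : ⋃ L ∈ 𝓛, (L : Set G) = Set.univ

namespace Representation

variable {k G V : Type*} [Field k] [Group G] [AddCommGroup V] [Module k V]

/-- A `G`-module `V` over `k` is finitary if `[V, g] = (g - 1)V` is finite-dimensional for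
every `g` in `G`. -/
def IsFinitary (ρ : Representation k G V) : Prop :=
  ∀ g : G, FiniteDimensional k (LinearMap.range (ρ g - LinearMap.id))

/-- The restriction of a `G`-module to a subgroup `L`. -/
def restrictSubgroup (ρ : Representation k G V) (L : Subgroup G) : Representation k L V :=
  ρ.comp L.subtype

/-- `V` is locally completely reducible with respect to `𝓛` if it is completely reducible as an
`L`-module for every `L` in `𝓛`. -/
def IsLocallyCompletelyReducible (ρ : Representation k G V) (𝓛 : Set (Subgroup G)) : Prop :=
  ∀ L ∈ 𝓛, (ρ.restrictSubgroup L).IsSemisimpleRepresentation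

/-- The `G`-submodule `[V, G]` of `V`, spanned over `k` by the elements `g v - v`. -/
def commutatorSub (ρ : Representation k G V) : Subrepresentation ρ where
  toSubmodule := Coinvariants.ker ρ
  apply_mem_toSubmodule h v hv := by
    induction hv using Submodule.span_induction with
    | mem x hx =>
      obtain ⟨⟨g, v⟩, rfl⟩ := hx
      dsimp only
      have e : ρ h (ρ g v - v) = (ρ (h * g) v - v) - (ρ h v - v) := by
        simp [map_mul]
      rw [e]
      exact sub_mem (Coinvariants.sub_mem_ker _ _) (Coinvariants.sub_mem_ker _ _)
    | zero => simp
    | add x y _ _ hx hy => rw [map_add]; exact add_mem hx hy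
    | smul a x _ hx => rw [map_smul]; exact Submodule.smul_mem _ a hx

end Representation

/-!
Inside the bidual `V**` a finitary module satisfies `[V**, G] ≤ V`: the map `(g - 1)**` sends `V**`
into `((g - 1)V)**`, which is `(g - 1)V` by finite dimensionality. Hence for a submodule
`W ≤ [V, G]` it suffices to find an equivariant map from `V` into `W^⊥⊥ ≤ V**` that is the identity
on `W`: on `[V, G]` its values lie in `V ∩ W^⊥⊥ = W`, and its kernel there is a complement of `W`.

Such a map into `V**` is a limit of the `L`-equivariant projections onto `W`, `L ∈ 𝓛`. It exists
because dual spaces are linearly compact and `Hom(V, V**)` is the dual of `V ⊗ V*`.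
-/

open LinearMap Module TensorProduct

section BidualLimit

/-- A linear map `Φ : M → N**` is a bidual limit of a family `P` of sets of linear maps `M → N` if
every affine equation in the matrix coefficients `l (p x)` that holds for all `p` in some `P i` is
inherited by `Φ`. It replaces a common element of the `P i`, which need not exist. An equation is
encoded as a prescribed value at a tensor in `M ⊗ N*`. -/
def IsBidualLimit {R M N ι : Type*} [CommRing R] [AddCommGroup M] [Module R M] [AddCommGroup N]
    [Module R N] (P : ι → Set (M →ₗ[R] N)) (Φ : M →ₗ[R] Dual R (Dual R N)) : Prop :=
  ∀ i (t : M ⊗[R] Dual R N) (c : R), (∀ p ∈ P i, lift (Dual.eval R N ∘ₗ p) t = c) → lift Φ t = c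

namespace IsBidualLimit

variable {R M N ι : Type*} [CommRing R] [AddCommGroup M] [Module R M] [AddCommGroup N] [Module R N]
  {P : ι → Set (M →ₗ[R] N)} {Φ : M →ₗ[R] Dual R (Dual R N)}

theorem apply_eq_eval (hΦ : IsBidualLimit P Φ) {i : ι} {x : M} {y : N} (h : ∀ p ∈ P i, p x = y) :
    Φ x = Dual.eval R N y := by
  ext l
  exact hΦ i (x ⊗ₜ l) (l y) fun p hp => congrArg l (h p hp)

theorem apply_mem_dualAnnihilator_dualAnnihilator (hΦ : IsBidualLimit P Φ) {i : ι} {x : M}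
    {W : Submodule R N} (h : ∀ p ∈ P i, p x ∈ W) :
    Φ x ∈ W.dualAnnihilator.dualAnnihilator :=
  (Submodule.mem_dualAnnihilator _).2 fun l hl =>
    hΦ i (x ⊗ₜ l) 0 fun p hp => (Submodule.mem_dualAnnihilator l).1 hl _ (h p hp)

theorem comp_eq_dualMap_dualMap_comp (hΦ : IsBidualLimit P Φ) {i : ι} {a : M →ₗ[R] M}
    {b : N →ₗ[R] N} (h : ∀ p ∈ P i, p ∘ₗ a = b ∘ₗ p) :
    Φ ∘ₗ a = b.dualMap.dualMap ∘ₗ Φ := by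
  ext x l
  have := hΦ i (a x ⊗ₜ l - x ⊗ₜ (l ∘ₗ b)) 0 fun p hp => by
    simpa [sub_eq_zero] using congrArg l (LinearMap.congr_fun (h p hp) x)
  rwa [map_sub, sub_eq_zero] at this

end IsBidualLimit

variable {k E M N ι : Type*} [Field k] [AddCommGroup E] [Module k E] [AddCommGroup M] [Module k M]
  [AddCommGroup N] [Module k N] [Nonempty ι]

theorem exists_dual_forall_apply_eq_of_directed (P : ι → Set (Dual k E))
    (hP : ∀ i, (P i).Nonempty) (hdir : Directed (· ⊇ ·) P) :
    ∃ φ : Dual k E, ∀ i x c, (∀ p ∈ P i, p x = c) → φ x = c := by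
  -- `S i` is the space of equations `p x = c` valid on `P i`; solving all of them at once means
  -- finding a functional on `E × k` that kills every `S i` but not `(0, 1)`.
  let S (i : ι) : Submodule k (E × k) := ⨅ p ∈ P i, ker (p.coprod (-LinearMap.id))
  have mem_S {i x c} : (x, c) ∈ S i ↔ ∀ p ∈ P i, p x = c := by
    simp [S, Submodule.mem_iInf, add_neg_eq_zero]
  have S_directed : Directed (· ≤ ·) S := fun i j =>
    (hdir i j).imp fun _ h => ⟨biInf_mono h.1, biInf_mono h.2⟩
  have consistent : ((0 : E), (1 : k)) ∉ ⨆ i, S i := by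
    rw [Submodule.mem_iSup_of_directed _ S_directed]
    rintro ⟨i, hi⟩
    obtain ⟨p, hp⟩ := hP i
    simpa using mem_S.1 hi p hp
  obtain ⟨F, hF, hSF⟩ := Submodule.exists_le_ker_of_notMem consistent
  refine ⟨-(F (0, 1))⁻¹ • (F ∘ₗ inl k E k), fun i x c h => ?_⟩
  have hFxc : F (x, 0) + c * F (0, 1) = 0 := by
    have : F (x, c) = 0 := hSF (Submodule.mem_iSup_of_mem i (mem_S.2 h))
    rwa [show (x, c) = (x, 0) + c • ((0 : E), (1 : k)) by simp, map_add, map_smul,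
      smul_eq_mul] at this
  simp [eq_neg_of_add_eq_zero_left hFxc, hF, mul_comm]

theorem exists_isBidualLimit (P : ι → Set (M →ₗ[k] N)) (hP : ∀ i, (P i).Nonempty)
    (hdir : Directed (· ⊇ ·) P) : ∃ Φ, IsBidualLimit P Φ := by
  let coefficients (p : M →ₗ[k] N) : Dual k (M ⊗[k] Dual k N) := lift (Dual.eval k N ∘ₗ p)
  obtain ⟨φ, hφ⟩ := exists_dual_forall_apply_eq_of_directed (fun i => coefficients '' P i)
    (fun i => (hP i).image _)
    (fun i j => (hdir i j).imp fun _ h => ⟨Set.image_mono h.1, Set.image_mono h.2⟩)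
  refine ⟨curry φ, fun i t c h => ?_⟩
  rw [show lift (curry φ) = φ from TensorProduct.ext' fun _ _ => by simp]
  exact hφ i t c (Set.forall_mem_image.2 h)

end BidualLimit

theorem range_dualMap_dualMap_le_range_eval {R M N : Type*} [CommRing R] [AddCommGroup M]
    [Module R M] [AddCommGroup N] [Module R N] (f : M →ₗ[R] N) [IsReflexive R (range f)] :
    range f.dualMap.dualMap ≤ range (Dual.eval R N) := by
  rintro _ ⟨ξ, rfl⟩
  refine ⟨(evalEquiv R (range f)).symm (f.rangeRestrict.dualMap.dualMap ξ), ?_⟩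
  ext l
  exact apply_evalEquiv_symm_apply (R := R) (M := range f) (l ∘ₗ (range f).subtype)
    (f.rangeRestrict.dualMap.dualMap ξ)

section BidualProjection

variable {k V : Type*} [Field k] [AddCommGroup V] [Module k V] {U W : Submodule k V}
  {Φ : V →ₗ[k] Dual k (Dual k V)}

theorem disjoint_ker_of_forall_apply_eq_eval (hΦW : ∀ w ∈ W, Φ w = Dual.eval k V w) :
    Disjoint W (ker Φ) :=
  disjoint_ker.2 fun w hw hΦw =>
    (forall_dual_apply_eq_zero_iff k w).1 (LinearMap.congr_fun ((hΦW w hw).symm.trans hΦw))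

theorem sup_inf_ker_eq_of_le_comap_range_eval (hWU : W ≤ U)
    (hΦW : ∀ w ∈ W, Φ w = Dual.eval k V w)
    (hΦ : ∀ u ∈ U, Φ u ∈ W.dualAnnihilator.dualAnnihilator)
    (hΦU : U ≤ (range (Dual.eval k V)).comap Φ) :
    W ⊔ U ⊓ ker Φ = U := by
  refine le_antisymm (sup_le hWU inf_le_left) fun u hu => ?_
  obtain ⟨w, hw⟩ : ∃ w, Dual.eval k V w = Φ u := hΦU hu
  have hwW : w ∈ W := by
    rw [← Subspace.comap_dualAnnihilator_dualAnnihilator W, Submodule.mem_comap, hw]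
    exact hΦ u hu
  refine Submodule.mem_sup.2 ⟨w, hwW, u - w, ⟨sub_mem hu (hWU hwW), ?_⟩, by abel⟩
  rw [SetLike.mem_coe, mem_ker, map_sub, hΦW w hwW, hw, sub_self]

end BidualProjection

section Semisimple

variable {R k G V : Type*} [Ring R] [Field k] [Monoid G] [AddCommGroup V] [Module R V] [Module k V]

theorem isCompl_toSubmodule {ρ : Representation R G V} {W C : Subrepresentation ρ}
    (h : IsCompl W C) : IsCompl W.toSubmodule C.toSubmodule :=
  .of_eq (congrArg Subrepresentation.toSubmodule h.inf_eq_bot)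
    (congrArg Subrepresentation.toSubmodule h.sup_eq_top)

theorem exists_isProj_and_forall_commute {ρ : Representation k G V}
    (hρ : ρ.IsSemisimpleRepresentation) (W : Subrepresentation ρ) :
    ∃ p : End k V, IsProj W.toSubmodule p ∧ ∀ g, Commute p (ρ g) := by
  obtain ⟨C, hC⟩ := hρ.exists_isCompl W
  have h := isCompl_toSubmodule hC
  refine ⟨W.toSubmodule.projection C.toSubmodule h, ⟨Submodule.projection_apply_mem h,
    fun _ => Submodule.projection_apply_of_mem_left h⟩, fun g => ?_⟩
  rw [(Submodule.isIdempotentElem_projection h).commute_iff, Submodule.range_projection,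
    Submodule.ker_projection]
  exact ⟨W.apply_mem_toSubmodule g, C.apply_mem_toSubmodule g⟩

/-- The correspondence between the subrepresentations of a subrepresentation `U` of `ρ` and the
subrepresentations of `ρ` contained in `U`; the analogue of `Submodule.mapIic`. -/
def subrepresentationMapIic {ρ : Representation R G V} (U : Subrepresentation ρ) :
    Subrepresentation U.toRepresentation ≃o Set.Iic U where
  toFun W := ⟨⟨W.toSubmodule.map U.toSubmodule.subtype, by
    rintro g _ ⟨x, hx, rfl⟩
    exact ⟨_, W.apply_mem_toSubmodule g hx, rfl⟩⟩, Submodule.map_subtype_le _ _⟩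
  invFun W := ⟨W.1.toSubmodule.comap U.toSubmodule.subtype,
    fun g _ hv => W.1.apply_mem_toSubmodule g hv⟩
  left_inv W := Subrepresentation.toSubmodule_injective
    (U.toSubmodule.mapIic.symm_apply_apply W.toSubmodule)
  right_inv W := Subtype.ext <| Subrepresentation.toSubmodule_injective <|
    congrArg Subtype.val (U.toSubmodule.mapIic.apply_symm_apply ⟨W.1.toSubmodule, W.2⟩)
  map_rel_iff' {W₁ W₂} := U.toSubmodule.mapIic.map_rel_iff (a := W₁.toSubmodule)
    (b := W₂.toSubmodule)

theorem isSemisimpleRepresentation_toRepresentation_iff {ρ : Representation k G V}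
    (U : Subrepresentation ρ) :
    U.toRepresentation.IsSemisimpleRepresentation ↔
      ∀ W ≤ U, ∃ W' ≤ U, W ⊓ W' = ⊥ ∧ W ⊔ W' = U :=
  (subrepresentationMapIic U).complementedLattice_iff.trans Set.Iic.complementedLattice_iff

end Semisimple

theorem dual_dual_apply {R G V : Type*} [CommRing R] [Group G] [AddCommGroup V] [Module R V]
    (ρ : Representation R G V) (g : G) : ρ.dual.dual g = (ρ g).dualMap.dualMap := by
  rw [Representation.dual_apply, Representation.dual_apply, inv_inv]
  rfl

section LocalSystem

variable {k G V : Type*} [Field k] [Group G] [AddCommGroup V] [Module k V]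
  {ρ : Representation k G V} {𝓛 : Set (Subgroup G)}

theorem IsLocalSystem.exists_mem (h𝓛 : IsLocalSystem 𝓛) (g : G) : ∃ L : 𝓛, g ∈ L.1 := by
  have : g ∈ ⋃ L ∈ 𝓛, (L : Set G) := h𝓛.iUnion_eq ▸ Set.mem_univ g
  simpa using this

/-- The projections of `V` onto a `G`-submodule `W` that commute with the action of the
subgroup `L`; nonemptiness means that `W` is a direct summand of `V` as an `L`-module. -/
def equivariantProjections (W : Subrepresentation ρ) (L : Subgroup G) : Set (End k V) :=
  {p | IsProj W.toSubmodule p ∧ ∀ g ∈ L, Commute p (ρ g)}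

theorem equivariantProjections_antitone (W : Subrepresentation ρ) :
    Antitone (equivariantProjections W) :=
  fun _ _ hL _ hp => ⟨hp.1, fun g hg => hp.2 g (hL hg)⟩

theorem equivariantProjections_nonempty (W : Subrepresentation ρ) {L : Subgroup G}
    (hL : (ρ.restrictSubgroup L).IsSemisimpleRepresentation) :
    (equivariantProjections W L).Nonempty := by
  obtain ⟨p, hpW, hp⟩ := exists_isProj_and_forall_commute hL
    ⟨W.toSubmodule, fun g _ hv => W.apply_mem_toSubmodule g hv⟩
  exact ⟨p, hpW, fun g hg => hp ⟨g, hg⟩⟩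

theorem exists_intertwiningMap_dual_dual (h𝓛 : IsLocalSystem 𝓛) (W : Subrepresentation ρ)
    (hW : ∀ L ∈ 𝓛, (equivariantProjections W L).Nonempty) :
    ∃ Φ : ρ.IntertwiningMap ρ.dual.dual,
      (∀ w ∈ W.toSubmodule, Φ w = Dual.eval k V w) ∧
        ∀ v, Φ v ∈ W.toSubmodule.dualAnnihilator.dualAnnihilator := by
  obtain ⟨L₀, -⟩ := h𝓛.exists_mem 1
  have : Nonempty 𝓛 := ⟨L₀⟩
  have antitone := equivariantProjections_antitone W
  have 𝓛_directed : Directed (· ≤ ·) ((↑) : 𝓛 → Subgroup G) :=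
    DirectedOn.directed_val h𝓛.directed
  obtain ⟨Φ, hΦ⟩ := exists_isBidualLimit (fun L : 𝓛 => equivariantProjections W L.1)
    (fun L => hW L.1 L.2)
    (fun L₁ L₂ => (𝓛_directed L₁ L₂).imp fun _ h => ⟨antitone h.1, antitone h.2⟩)
  refine ⟨⟨Φ, fun g => ?_⟩, fun w hw => ?_, fun v => ?_⟩
  · obtain ⟨L, hg⟩ := h𝓛.exists_mem g
    rw [dual_dual_apply]
    exact hΦ.comp_eq_dualMap_dualMap_comp (i := L) fun p hp => (hp.2 g hg).eq
  · exact hΦ.apply_eq_eval (i := L₀) fun p hp => hp.1.map_id w hw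
  · exact hΦ.apply_mem_dualAnnihilator_dualAnnihilator (i := L₀) fun p hp => hp.1.map_mem v

theorem commutatorSub_dual_dual_le_range_eval (hfin : ρ.IsFinitary) :
    ρ.dual.dual.commutatorSub.toSubmodule ≤ range (Dual.eval k V) := by
  refine Submodule.span_le.2 ?_
  rintro _ ⟨⟨g, ξ⟩, rfl⟩
  have := hfin g
  refine range_dualMap_dualMap_le_range_eval (ρ g - LinearMap.id) ⟨ξ, ?_⟩
  ext l
  simp only [dual_dual_apply]
  simp [dualMap_apply', comp_sub]

theorem commutatorSub_le_comap {V' : Type*} [AddCommGroup V'] [Module k V']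
    {σ : Representation k G V'} (Φ : ρ.IntertwiningMap σ) :
    ρ.commutatorSub.toSubmodule ≤ σ.commutatorSub.toSubmodule.comap Φ.toLinearMap := by
  refine Submodule.span_le.2 ?_
  rintro _ ⟨⟨g, v⟩, rfl⟩
  rw [SetLike.mem_coe, Submodule.mem_comap, map_sub, Φ.toLinearMap_apply, Φ.isIntertwining]
  exact Representation.Coinvariants.sub_mem_ker g (Φ v)

theorem exists_complement_in_commutatorSub (h𝓛 : IsLocalSystem 𝓛) (hfin : ρ.IsFinitary)
    {W : Subrepresentation ρ} (hWU : W ≤ ρ.commutatorSub)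
    (hW : ∀ L ∈ 𝓛, (equivariantProjections W L).Nonempty) :
    ∃ W' ≤ ρ.commutatorSub, W ⊓ W' = ⊥ ∧ W ⊔ W' = ρ.commutatorSub := by
  obtain ⟨Φ, hΦW, hΦ⟩ := exists_intertwiningMap_dual_dual h𝓛 W hW
  have hΦU : ρ.commutatorSub.toSubmodule ≤ (range (Dual.eval k V)).comap Φ.toLinearMap :=
    (commutatorSub_le_comap Φ).trans
      (Submodule.comap_mono (commutatorSub_dual_dual_le_range_eval hfin))
  have hinf := (disjoint_ker_of_forall_apply_eq_eval hΦW).mono_right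
    (inf_le_right (a := ρ.commutatorSub.toSubmodule))
  have hsup := sup_inf_ker_eq_of_le_comap_range_eval hWU hΦW (fun u _ => hΦ u) hΦU
  exact ⟨ρ.commutatorSub ⊓ Φ.ker, inf_le_left, Subrepresentation.toSubmodule_injective hinf.eq_bot,
    Subrepresentation.toSubmodule_injective hsup⟩

end LocalSystem

theorem corollary4 {k G V : Type*} [Field k] [Group G] [AddCommGroup V] [Module k V]
    (ρ : Representation k G V) (𝓛 : Set (Subgroup G)) (h𝓛 : IsLocalSystem 𝓛)
    (hfin : ρ.IsFinitary) (hlcr : ρ.IsLocallyCompletelyReducible 𝓛) :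
    ρ.commutatorSub.toRepresentation.IsSemisimpleRepresentation ∧
      ∀ W : Subrepresentation ρ, W ≤ ρ.commutatorSub →
        ∃ W' : Subrepresentation ρ, W ⊔ W' = ρ.commutatorSub ∧ W ⊓ W' = ⊥ := by
  have complement (W : Subrepresentation ρ) (hW : W ≤ ρ.commutatorSub) :=
    exists_complement_in_commutatorSub h𝓛 hfin hW fun L hL =>
      equivariantProjections_nonempty W (hlcr L hL)
  refine ⟨(isSemisimpleRepresentation_toRepresentation_iff _).2 complement, fun W hW => ?_⟩
  obtain ⟨W', -, hinf, hsup⟩ := complement W hW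
  exact ⟨W', hsup, hinf⟩
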